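/- Fix $N\ge 7$ and $a,b\in\mathbb{C}$ with $b\neq 0$ and $|a|^2\ge \frac{6(2N-5)}{N(N-1)(N-4)}|b|^2$. For qubits, let $|D^k_i\rangle=\binom{k}{i}^{-1/2}\sum_{x\in\{0,1\}^k,\ x_1+\dots+x_k=i}|x\rangle$ be the Dicke states, and consider the $N$-qubit pure state $|\psi\rangle=a|D^N_0\rangle+b|D^N_{N-3}\rangle$ (up to normalization), with density operator $|\psi\rangle\langle\psi|/\langle\psi|\psi\rangle$; its $k$-qubit reductions are the partial traces of this operator over any $N-k$ qubits. A state is *fully separable* if it is a convex combination of projectors onto product vectors $|\varphi_1\rangle\otimes\cdots\otimes|\varphi_k\rangle$, and *entangled* otherwise. It is *genuinely entangled* if it is not a convex combination of states $\rho_S\otimes\rho_{\bar S}$, where the bipartition $S|\bar S$ of the particles into two nonempty parts may vary from term to term. A genuinely entangled pure state of $N$ particles is *strong $m$-resistant* if its reductions to any $N-m$ particles are genuinely entangled and its reductions to any $N-m-1$ particles are fully separable. A state is *symmetric* if it is supported on the symmetric subspace. Then: 1. $|\psi\rangle$ is strong $(N-3)$-resistant. 2. Every $2$-qubit reduction of $|\psi\rangle$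 is fully separable. 3. Every $3$-qubit reduction of $|\psi\rangle$ is symmetric, entangled and genuinely entangled. It is a mixture of Dicke states $\sum_{i=0}^{3}p_i|D^3_i\rangle\langle D^3_i|$, $p_i\in\mathbb{R}$, whose Hankel matrix $M_1=\begin{pmatrix}\alpha_1&\alpha_2\\ \alpha_2&\alpha_3\end{pmatrix}$, $\alpha_i=p_i\binom{3}{i}^{-1}$, is not positive semidefinite. 4. Every entangled symmetric state of finitely many qubits is genuinely entangled. -/

import Mathlib

/-! Finite families of particles, indexed by `ι`, each of local dimension `d`.
The computational basis of the joint space is `ι → Fin d`; vectors are functions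
`(ι → Fin d) → ℂ`, operators are matrices indexed by `ι → Fin d`. -/

namespace ParticleLoss

noncomputable section

open scoped ComplexOrder

/-- Operators on the joint space of particles `ι` of local dimension `d`. -/
abbrev Op (ι : Type) (d : ℕ) : Type := Matrix (ι → Fin d) (ι → Fin d) ℂ

/-- A (mixed) quantum state: a positive semidefinite operator of trace one. -/
def IsState {ι : Type} [Fintype ι] [DecidableEq ι] {d : ℕ} (ρ : Op ι d) : Prop :=
  ρ.PosSemidef ∧ ρ.trace = 1

/-- The (unnormalised) rank one operator `|ψ⟩⟨ψ|`. -/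
def ketbra {ι : Type} {d : ℕ} (ψ : (ι → Fin d) → ℂ) : Op ι d :=
  Matrix.vecMulVec ψ (star ψ)

/-- The density operator `|ψ⟩⟨ψ| / ⟨ψ|ψ⟩` of the pure state represented by a nonzero vector. -/
def pureState {ι : Type} [Fintype ι] [DecidableEq ι] {d : ℕ} (ψ : (ι → Fin d) → ℂ) : Op ι d :=
  (∑ x, ‖ψ x‖ ^ 2)⁻¹ • ketbra ψ

/-- The vector `⊗ᵢ φᵢ`. -/
def productVector {ι : Type} [Fintype ι] {d : ℕ} (φ : ι → EuclideanSpace ℂ (Fin d)) :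
    (ι → Fin d) → ℂ :=
  fun x => ∏ i, φ i (x i)

/-- A fully separable operator: a convex combination of projectors
`|φ₁⟩⟨φ₁| ⊗ ⋯ ⊗ |φ_N⟩⟨φ_N|` with unit vectors `φᵢ`. -/
def IsFullySeparable {ι : Type} [Fintype ι] {d : ℕ} (ρ : Op ι d) : Prop :=
  ρ ∈ convexHull ℝ {τ : Op ι d | ∃ φ : ι → EuclideanSpace ℂ (Fin d),
    (∀ i, ‖φ i‖ = 1) ∧ τ = ketbra (productVector φ)}

/-- An entangled state: a state that is not fully separable. -/
def IsEntangled {ι : Type} [Fintype ι] [DecidableEq ι] {d : ℕ} (ρ : Op ι d) : Prop :=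
  IsState ρ ∧ ¬ IsFullySeparable ρ

/-- The tensor product of an operator on the particles in `S` and one on those outside `S`. -/
def splitProduct {ι : Type} {d : ℕ} (S : Finset ι)
    (σ : Op {i // i ∈ S} d) (τ : Op {i // i ∉ S} d) : Op ι d :=
  fun x y => σ (fun i => x i) (fun i => y i) * τ (fun i => x i) (fun i => y i)

/-- A biseparable operator: a convex combination of products `ρ_S ⊗ ρ_{Sᶜ}` of states, where the
bipartition `S | Sᶜ` into nonempty parts may vary from term to term. -/
def IsBiseparable {ι : Type} [Fintype ι] [DecidableEq ι] {d : ℕ} (ρ : Op ι d) : Prop :=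
  ρ ∈ convexHull ℝ {τ : Op ι d | ∃ S : Finset ι, S.Nonempty ∧ Sᶜ.Nonempty ∧
    ∃ (σ₁ : Op {i // i ∈ S} d) (σ₂ : Op {i // i ∉ S} d),
      IsState σ₁ ∧ IsState σ₂ ∧ τ = splitProduct S σ₁ σ₂}

/-- A genuinely (multipartite) entangled state: a state that is not biseparable. -/
def IsGenuinelyEntangled {ι : Type} [Fintype ι] [DecidableEq ι] {d : ℕ} (ρ : Op ι d) : Prop :=
  IsState ρ ∧ ¬ IsBiseparable ρ

/-- The reduction `ρ_T` of `ρ` to the particles in `T`: the partial trace over all the others. -/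
def reduction {ι : Type} [Fintype ι] [DecidableEq ι] {d : ℕ} (ρ : Op ι d) (T : Finset ι) :
    Op {i // i ∈ T} d :=
  fun x y => ∑ z : {i // i ∉ T} → Fin d,
    ρ ((Equiv.piEquivPiSubtypeProd (fun i => i ∈ T) (fun _ => Fin d)).symm (x, z))
      ((Equiv.piEquivPiSubtypeProd (fun i => i ∈ T) (fun _ => Fin d)).symm (y, z))

/-- A pure state is strong `m`-resistant if it is genuinely entangled, remains so after the loss of
any `m` particles, and becomes fully separable after the loss of any `m + 1` particles. -/
def IsStrongResistant {ι : Type} [Fintype ι] [DecidableEq ι] {d : ℕ}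
    (ψ : (ι → Fin d) → ℂ) (m : ℕ) : Prop :=
  IsGenuinelyEntangled (pureState ψ) ∧
  (∀ J : Finset ι, J.card = m → IsGenuinelyEntangled (reduction (pureState ψ) Jᶜ)) ∧
  (∀ J : Finset ι, J.card = m + 1 → IsFullySeparable (reduction (pureState ψ) Jᶜ))

/-- A symmetric (bosonic) state: a state supported on the symmetric subspace, that is, `P ρ = ρ`
for each operator `P` permuting the particles. -/
def IsSymmetricState {ι : Type} [Fintype ι] [DecidableEq ι] {d : ℕ} (ρ : Op ι d) : Prop :=
  IsState ρ ∧ ∀ (π : Equiv.Perm ι) (x y : ι → Fin d), ρ (x ∘ π) y = ρ x y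

/-- The Dicke vector `|D^N_m⟩` of the `N` qubits `ι`: the normalised equal superposition of the
basis vectors with exactly `m` ones. -/
def dicke (ι : Type) [Fintype ι] (m : ℕ) : (ι → Fin 2) → ℂ :=
  fun x => if (Finset.univ.filter (fun i => x i = 1)).card = m then
    (((1 / Real.sqrt ((Fintype.card ι).choose m) : ℝ)) : ℂ) else 0

/-- `∑_{i=0}^{k} b_i |D^k_i⟩⟨D^k_i|` for `k` qubits `ι`. -/
def dickeMixture (ι : Type) [Fintype ι] (b : ℕ → ℝ) : Op ι 2 :=
  ∑ i ∈ Finset.range (Fintype.card ι + 1), b i • ketbra (dicke ι i)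

/-- The Hankel matrix `M₁` of the mixture `∑_{i=0}^{k} b_i |D^k_i⟩⟨D^k_i|`: with
`a_i = b_i / (k choose i)`, its rows are `(a_1, …, a_{m₁}), …, (a_{m₁}, …, a_{2m₁-1})`, where
`m₁ = ⌊(k+1)/2⌋`. -/
def hankelOne (k : ℕ) (b : ℕ → ℝ) : Matrix (Fin ((k + 1) / 2)) (Fin ((k + 1) / 2)) ℝ :=
  fun i j => b (i + j + 1) / (k.choose (i + j + 1))

end

end ParticleLoss

open ParticleLoss

/-! Put N = n + 7 and let β be b over the square root of (N choose N-3): ψ has amplitude a at weight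
0 and β at weight n + 4. In a reduction to k ≤ 3 qubits the two levels cannot interfere, since the
kept parts would have to differ in weight by n + 4 > 3. The reduction is therefore a Dicke mixture
with explicit α_i (`reduction_twoLevel`).

For k = 3, a enters α_0 only, and α_1 α_3 < α_2² always. This determinant is a minor of the partial
transpose, so the reduction is entangled (`IsFullySeparable.minor_nonneg`). For k = 2, the bound on
|a| gives α_0 α_2 ≥ α_1², and averaging product vectors over phases writes the reduction as a
separable mixture.

Genuine entanglement comes from symmetry. The vectors of a biseparable decomposition of a symmetric
state are symmetric, and a symmetric qubit vector that factors across one bipartition is fully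
product, because its amplitudes form a rank one Hankel array (`hankel_rank_one`). So biseparable
symmetric states are fully separable. -/

namespace ParticleLoss

open scoped ComplexOrder
open Finset

/-! ### Pure states, reductions, and full separability -/

section General

variable {ι : Type} [Fintype ι] {d : ℕ}

omit [Fintype ι] in
lemma ketbra_apply (ψ : (ι → Fin d) → ℂ) (x y : ι → Fin d) :
    ketbra ψ x y = ψ x * star (ψ y) := by
  simp [ketbra, Matrix.vecMulVec_apply]

omit [Fintype ι] in
lemma ketbra_smul (c : ℂ) (ψ : (ι → Fin d) → ℂ) :
    ketbra (c • ψ) = (‖c‖ ^ 2 : ℝ) • ketbra ψ := by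
  ext x y
  have := Complex.mul_conj c
  rw [Complex.normSq_eq_norm_sq] at this
  simp only [ketbra_apply, Pi.smul_apply, smul_eq_mul, Matrix.smul_apply, Complex.real_smul,
    star_mul', ← this, Complex.star_def]
  ring

lemma posSemidef_ketbra (ψ : (ι → Fin d) → ℂ) : (ketbra ψ).PosSemidef :=
  Matrix.posSemidef_vecMulVec_self_star ψ

variable [DecidableEq ι]

lemma trace_ketbra (ψ : (ι → Fin d) → ℂ) :
    (ketbra ψ).trace = ((∑ x, ‖ψ x‖ ^ 2 : ℝ) : ℂ) := by
  simp only [Matrix.trace, Matrix.diag_apply, ketbra_apply, Complex.star_def, Complex.mul_conj,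
    Complex.normSq_eq_norm_sq, Complex.ofReal_sum]

lemma sum_norm_sq_pos {ψ : (ι → Fin d) → ℂ} {x : ι → Fin d} (h : ψ x ≠ 0) :
    0 < ∑ x, ‖ψ x‖ ^ 2 :=
  sum_pos' (fun _ _ => by positivity) ⟨x, mem_univ _, by positivity⟩

lemma isState_pureState {ψ : (ι → Fin d) → ℂ} {x : ι → Fin d} (h : ψ x ≠ 0) :
    IsState (pureState ψ) := by
  have hpos := sum_norm_sq_pos h
  refine ⟨(posSemidef_ketbra ψ).smul (inv_nonneg.2 hpos.le), ?_⟩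
  rw [pureState, Matrix.trace_smul, trace_ketbra, Complex.real_smul, ← Complex.ofReal_mul,
    inv_mul_cancel₀ hpos.ne', Complex.ofReal_one]

lemma pureState_apply (ψ : (ι → Fin d) → ℂ) (x y : ι → Fin d) :
    pureState ψ x y = ((∑ x, ‖ψ x‖ ^ 2)⁻¹ : ℝ) * (ψ x * star (ψ y)) := by
  rw [pureState, Matrix.smul_apply, ketbra_apply, Complex.real_smul]

/-- The configuration which is `x` on `T` and `z` off `T`. -/
def glue (T : Finset ι) (x : {i // i ∈ T} → Fin d) (z : {i // i ∉ T} → Fin d) : ι → Fin d :=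
  (Equiv.piEquivPiSubtypeProd (fun i => i ∈ T) (fun _ => Fin d)).symm (x, z)

lemma reduction_apply (ρ : Op ι d) (T : Finset ι) (x y : {i // i ∈ T} → Fin d) :
    reduction ρ T x y = ∑ z, ρ (glue T x z) (glue T y z) := rfl

omit [Fintype ι] in
lemma glue_mem (T : Finset ι) (x : {i // i ∈ T} → Fin d) (z : {i // i ∉ T} → Fin d)
    (i : {i // i ∈ T}) : glue T x z i = x i := by
  simp [glue, Equiv.piEquivPiSubtypeProd]

omit [Fintype ι] in
lemma glue_not_mem (T : Finset ι) (x : {i // i ∈ T} → Fin d) (z : {i // i ∉ T} → Fin d)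
    (i : {i // i ∉ T}) : glue T x z i = z i := by
  simp [glue, Equiv.piEquivPiSubtypeProd, i.2]

lemma IsState.reduction_pureState {ψ : (ι → Fin d) → ℂ} {x : ι → Fin d} (h : ψ x ≠ 0)
    (T : Finset ι) : IsState (reduction (pureState ψ) T) := by
  constructor
  · have : reduction (pureState ψ) T =
        ∑ z, (∑ x, ‖ψ x‖ ^ 2)⁻¹ • ketbra (fun x => ψ (glue T x z)) := by
      ext x y
      simp only [reduction_apply, Matrix.sum_apply, pureState_apply, Matrix.smul_apply,
        ketbra_apply, Complex.real_smul]
    rw [this]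
    exact Matrix.posSemidef_sum _ fun z _ =>
      (posSemidef_ketbra _).smul (inv_nonneg.2 (sum_norm_sq_pos h).le)
  · rw [← (isState_pureState h).2]
    simp only [Matrix.trace, Matrix.diag_apply, reduction_apply]
    rw [← Fintype.sum_prod_type']
    exact Equiv.sum_comp (Equiv.piEquivPiSubtypeProd (fun i => i ∈ T) (fun _ => Fin d)).symm
      (fun w => pureState ψ w w)

lemma trace_ketbra_productVector (φ : ι → EuclideanSpace ℂ (Fin d)) :
    (ketbra (productVector φ)).trace = ((∏ i, ‖φ i‖ ^ 2 : ℝ) : ℂ) := by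
  rw [trace_ketbra]
  congr 1
  simp only [EuclideanSpace.norm_sq_eq, productVector, norm_prod, ← prod_pow]
  exact (Fintype.prod_sum fun i j => ‖φ i j‖ ^ 2).symm

/-- A trace one nonnegative combination of product projectors is fully separable. -/
lemma isFullySeparable_of_eq_sum [NeZero d] {κ : Type} [Fintype κ] {c : κ → ℝ}
    (hc : ∀ k, 0 ≤ c k) (φ : κ → ι → EuclideanSpace ℂ (Fin d)) {ρ : Op ι d}
    (hρ : ρ = ∑ k, c k • ketbra (productVector (φ k))) (htr : ρ.trace = 1) :
    IsFullySeparable ρ := by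
  have hw : ∑ k, c k * ∏ i, ‖φ k i‖ ^ 2 = 1 := by
    rw [hρ] at htr
    simp only [Matrix.trace_sum, Matrix.trace_smul, trace_ketbra_productVector,
      Complex.real_smul] at htr
    exact_mod_cast htr
  -- A zero vector is replaced by an arbitrary unit vector; its term then has weight zero.
  let u : κ → ι → EuclideanSpace ℂ (Fin d) := fun k i =>
    if φ k i = 0 then EuclideanSpace.single 0 1 else ((‖φ k i‖⁻¹ : ℝ) : ℂ) • φ k i
  have hu : ∀ k i, ‖u k i‖ = 1 := by
    intro k i
    by_cases h : φ k i = 0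
    · simp [u, h]
    · have : ‖φ k i‖ ≠ 0 := norm_ne_zero_iff.2 h
      simp only [u, h, if_false, norm_smul, Complex.norm_real, norm_inv, norm_norm]
      exact inv_mul_cancel₀ this
  have hφ : ∀ k i, φ k i = ((‖φ k i‖ : ℝ) : ℂ) • u k i := by
    intro k i
    by_cases h : φ k i = 0
    · simp [h]
    · have : ((‖φ k i‖ : ℝ) : ℂ) ≠ 0 := by exact_mod_cast norm_ne_zero_iff.2 h
      simp only [u, h, if_false, smul_smul, Complex.ofReal_inv]
      rw [mul_inv_cancel₀ this, one_smul]
  have hprod : ∀ k, productVector (φ k) =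
      ((∏ i, ‖φ k i‖ : ℝ) : ℂ) • productVector (u k) := by
    intro k
    ext x
    simp only [productVector, Pi.smul_apply, smul_eq_mul, Complex.ofReal_prod, ← prod_mul_distrib]
    refine prod_congr rfl fun i _ => ?_
    conv_lhs => rw [hφ k i]
    simp
  have hρ' : ρ = ∑ k, (c k * ∏ i, ‖φ k i‖ ^ 2) • ketbra (productVector (u k)) := by
    rw [hρ]
    refine sum_congr rfl fun k _ => ?_
    rw [hprod k, ketbra_smul, smul_smul, Complex.norm_real, Real.norm_eq_abs, sq_abs, prod_pow]
  rw [hρ']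
  exact (convex_convexHull ℝ _).sum_mem
    (fun k _ => mul_nonneg (hc k) (prod_nonneg fun i _ => by positivity)) hw
    (fun k _ => subset_convexHull ℝ _ ⟨u k, hu k, rfl⟩)

omit [DecidableEq ι] in
/-- Positivity of a two by two minor of the partial transpose of a fully separable operator. -/
lemma IsFullySeparable.minor_nonneg {ρ : Op ι d} (hρ : IsFullySeparable ρ)
    {x y x' y' : ι → Fin d}
    (h : ∀ i, x' i = x i ∧ y' i = y i ∨ x' i = y i ∧ y' i = x i) (t : ℝ) :
    0 ≤ t ^ 2 * (ρ x x).re - 2 * t * (ρ x' y').re + (ρ y y).re := by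
  -- For fixed t the condition is linear in ρ, unlike the determinant of the minor, so it suffices
  -- to check product projectors.
  have hconv : Convex ℝ {ρ : Op ι d |
      0 ≤ t ^ 2 * (ρ x x).re - 2 * t * (ρ x' y').re + (ρ y y).re} := by
    intro A hA B hB p q hp hq _
    simp only [Set.mem_ofPred_eq, Matrix.add_apply, Matrix.smul_apply, Complex.add_re,
      Complex.real_smul, Complex.re_ofReal_mul] at *
    nlinarith [mul_nonneg hp hA, mul_nonneg hq hB]
  refine convexHull_min ?_ hconv hρ
  rintro _ ⟨φ, -, rfl⟩
  set v := productVector φ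
  -- Exchanging the local indices of x and y at some particles only permutes the factors of the
  -- product.
  have hnorm : ‖v x' * star (v y')‖ = ‖v x‖ * ‖v y‖ := by
    rw [norm_mul, norm_star]
    simp only [v, productVector, norm_prod, ← prod_mul_distrib]
    refine prod_congr rfl fun i _ => ?_
    rcases h i with ⟨h1, h2⟩ | ⟨h1, h2⟩ <;> rw [h1, h2]
    exact mul_comm _ _
  have habs := Complex.abs_re_le_norm (v x' * star (v y'))
  rw [hnorm] at habs
  have hd : ∀ w, (ketbra v w w).re = ‖v w‖ ^ 2 := fun w => by
    rw [ketbra_apply, Complex.star_def, Complex.mul_conj, Complex.normSq_eq_norm_sq,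
      Complex.ofReal_re]
  simp only [Set.mem_ofPred_eq, hd]
  rw [ketbra_apply]
  set r := (v x' * star (v y')).re
  have h1 : t * r ≤ |t| * (‖v x‖ * ‖v y‖) := by
    calc t * r ≤ |t * r| := le_abs_self _
      _ = |t| * |r| := abs_mul _ _
      _ ≤ _ := by gcongr
  have h2 := sq_nonneg (|t| * ‖v x‖ - ‖v y‖)
  have h3 := sq_abs t
  nlinarith

omit [Fintype ι] [DecidableEq ι] in
/-- The vectors of a decomposition of an operator supported on the symmetric subspace are
symmetric. -/
lemma symmetric_of_sum_ketbra {κ : Type} [Fintype κ] (v : κ → (ι → Fin d) → ℂ)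
    (h : ∀ (π : Equiv.Perm ι) (x y : ι → Fin d),
      (∑ k, ketbra (v k)) (x ∘ π) y = (∑ k, ketbra (v k)) x y)
    (k : κ) (π : Equiv.Perm ι) (x : ι → Fin d) : v k (x ∘ π) = v k x := by
  simp only [Matrix.sum_apply, ketbra_apply] at h
  -- Expanded, the sum consists of four entries of the operator, which cancel in pairs by invariance
  -- of the first index.
  have key : ∑ k, ‖v k (x ∘ π) - v k x‖ ^ 2 = 0 := by
    have : ((∑ k, ‖v k (x ∘ π) - v k x‖ ^ 2 : ℝ) : ℂ) = 0 := by
      push_cast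
      simp only [← Complex.mul_conj']
      have h1 := h π x x
      have h2 := h π x (x ∘ π)
      simp only [map_sub, sub_mul, mul_sub, sum_sub_distrib, Complex.star_def] at *
      rw [h1, h2]
      ring
    exact_mod_cast this
  rw [sum_eq_zero_iff_of_nonneg fun _ _ => by positivity] at key
  simpa [sub_eq_zero] using key k (mem_univ k)

end General

/-! ### Qubit configurations counted by weight -/

section Weight

variable {ι : Type} [Fintype ι]

/-- The number of ones of a configuration of qubits. -/
def weight (x : ι → Fin 2) : ℕ := (univ.filter (fun i => x i = 1)).card

lemma weight_le (x : ι → Fin 2) : weight x ≤ Fintype.card ι := card_le_univ _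

lemma weight_comp {κ : Type} [Fintype κ] (π : κ ≃ ι) (x : ι → Fin 2) :
    weight (x ∘ π) = weight x := by
  simp only [weight, card_filter, Function.comp_apply]
  exact Equiv.sum_comp π fun i => if x i = 1 then 1 else 0

lemma weight_cons {n : ℕ} (a : Fin 2) (u : Fin n → Fin 2) :
    weight (Fin.cons a u : Fin (n + 1) → Fin 2) = (if a = 1 then 1 else 0) + weight u := by
  simp only [weight, card_filter, Fin.sum_univ_succ, Fin.cons_zero, Fin.cons_succ]

lemma exists_weight_eq {k : ℕ} (hk : k ≤ Fintype.card ι) : ∃ x : ι → Fin 2, weight x = k := by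
  classical
  obtain ⟨s, -, hs⟩ := exists_subset_card_eq (s := (univ : Finset ι)) hk
  refine ⟨fun i => if i ∈ s then 1 else 0, ?_⟩
  rw [weight, ← hs]
  congr 1
  ext i
  simp

lemma exists_perm_of_weight_eq {x y : ι → Fin 2} (h : weight x = weight y) :
    ∃ π : Equiv.Perm ι, y = x ∘ π := by
  classical
  have hcard : Fintype.card {i // y i = 1} = Fintype.card {i // x i = 1} := by
    simpa [Fintype.card_subtype, weight] using h.symm
  let e := Fintype.equivOfCardEq hcard
  refine ⟨e.extendSubtype, funext fun i => ?_⟩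
  by_cases hi : y i = 1
  · rw [hi, Function.comp_apply, e.extendSubtype_mem i hi]
  · have := e.extendSubtype_not_mem i hi
    simp only [Function.comp_apply]
    omega

lemma weight_glue [DecidableEq ι] (T : Finset ι) (x : {i // i ∈ T} → Fin 2)
    (z : {i // i ∉ T} → Fin 2) : weight (glue T x z) = weight x + weight z := by
  simp only [weight, card_filter]
  rw [← Fintype.sum_subtype_add_sum_subtype (fun i => i ∈ T)]
  simp only [glue_mem, glue_not_mem]
  congr 1
  exact sum_congr (by ext; simp) fun _ _ => rfl

lemma sum_weight [DecidableEq ι] {M : Type*} [AddCommMonoid M] (F : ℕ → M) :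
    ∑ x : ι → Fin 2, F (weight x) =
      ∑ j ∈ range (Fintype.card ι + 1), (Fintype.card ι).choose j • F j := by
  rw [← card_univ, ← sum_powerset_apply_card F (x := (univ : Finset ι)), powerset_univ]
  refine Fintype.sum_bijective (fun x : ι → Fin 2 => univ.filter fun i => x i = 1) ?_ _ _
    fun x => rfl
  refine Function.bijective_iff_has_inverse.2 ⟨fun s i => if i ∈ s then 1 else 0, ?_, ?_⟩
  · intro x
    funext i
    by_cases h : x i = 1
    · simp [h]
    · simp only [mem_filter, mem_univ, true_and, h, if_false]
      omega
  · intro s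
    ext i
    simp

/-- Together with `productVector_ones`, this realises the two alternatives of `hankel_rank_one` as
product vectors. -/
lemma productVector_one_const (z : ℂ) :
    productVector (fun _ : ι => !₂[1, z]) = fun x => z ^ weight x := by
  funext x
  rw [productVector, weight, ← prod_const, prod_filter]
  refine prod_congr rfl fun i _ => ?_
  rcases Fin.exists_fin_two.1 ⟨x i, rfl⟩ with h | h <;> simp [h]

lemma productVector_ones :
    productVector (fun _ : ι => !₂[(0 : ℂ), 1]) =
      fun x => if weight x = Fintype.card ι then 1 else 0 := by
  funext x
  have : weight x = Fintype.card ι ↔ ∀ i, x i = 1 := by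
    rw [weight, ← card_univ, card_filter_eq_iff]
    simp
  rw [productVector]
  split_ifs with h
  · exact prod_eq_one fun i _ => by simp [this.1 h i]
  · rw [this] at h
    push Not at h
    obtain ⟨i, hi⟩ := h
    refine prod_eq_zero (mem_univ i) ?_
    have : x i = 0 := by omega
    simp [this]

end Weight

/-- A Hankel array of rank one is geometric, or supported at its last entry. -/
lemma hankel_rank_one {g : ℕ → ℂ} {p q : ℕ} (hp : 1 ≤ p) (hq : 1 ≤ q)
    (h : ∀ i ≤ p, ∀ i' ≤ p, ∀ j ≤ q, ∀ j' ≤ q, g (i + j) * g (i' + j') = g (i + j') * g (i' + j)) :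
    (∃ c r : ℂ, ∀ k ≤ p + q, g k = c * r ^ k) ∨ ∀ k < p + q, g k = 0 := by
  by_cases h0 : g 0 = 0
  · right
    intro k
    induction k with
    | zero => exact fun _ => h0
    | succ k ih =>
      intro hk
      -- The minor on rows i, i+1 and columns j, j+1 gives g(k+1)² = g(k) g(k+2) = 0. It exists only
      -- for k + 2 ≤ p + q, so the last entry stays free.
      obtain ⟨i, j, hi, hj, rfl⟩ : ∃ i j, i + 1 ≤ p ∧ j + 1 ≤ q ∧ i + j = k :=
        ⟨min k (p - 1), k - min k (p - 1), by omega, by omega, by omega⟩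
      have := h i (by omega) (i + 1) hi j (by omega) (j + 1) hj
      rw [ih (by omega), zero_mul, ← add_assoc, add_right_comm i 1 j] at this
      exact mul_self_eq_zero.1 this.symm
  · left
    -- The first row and column are geometric; g(0) g(i+j) = g(i) g(j) then gives the other entries.
    have hgeo : ∀ k, k ≤ p ∨ k ≤ q → g k = g 0 * (g 1 / g 0) ^ k := by
      intro k
      induction k with
      | zero => simp
      | succ k ih =>
        intro hk
        have h1 : g 0 * g (k + 1) = g 1 * g k := by
          rcases hk with hk | hk
          · have := h k (by omega) (k + 1) hk 0 (by omega) 1 hq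
            have := h 0 (by omega) k (by omega) 0 (by omega) 1 hq
            simp only [zero_add, add_zero] at this
            rw [this]
          · have := h 0 (by omega) 1 hp 0 (by omega) k (by omega)
            simp only [zero_add, add_zero, add_comm 1 k] at this
            rw [this, mul_comm]
        have h2 := ih (by omega)
        rw [pow_succ, ← mul_assoc, ← h2]
        field_simp
        linear_combination h1
    refine ⟨g 0, g 1 / g 0, fun k hk => ?_⟩
    obtain ⟨i, j, hi, hj, rfl⟩ : ∃ i j, i ≤ p ∧ j ≤ q ∧ i + j = k :=
      ⟨min k p, k - min k p, by omega, by omega, by omega⟩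
    have := h 0 (by omega) i hi 0 (by omega) j hj
    simp only [zero_add, add_zero] at this
    rw [hgeo i (Or.inl hi), hgeo j (Or.inr hj)] at this
    apply mul_left_cancel₀ h0
    rw [this, pow_add]
    ring

/-! ### Symmetric states: biseparable implies fully separable -/

section Symmetric

variable {ι : Type} [Fintype ι] [DecidableEq ι]

/-- A symmetric vector of qubits which is a product across a bipartition is a multiple of a
fully product vector. -/
lemma exists_eq_smul_productVector {v : (ι → Fin 2) → ℂ}
    (hv : ∀ (π : Equiv.Perm ι) x, v (x ∘ π) = v x) {S : Finset ι} (hS : S.Nonempty)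
    (hS' : Sᶜ.Nonempty) (s : ({i // i ∈ S} → Fin 2) → ℂ) (t : ({i // i ∉ S} → Fin 2) → ℂ)
    (hst : ∀ x z, v (glue S x z) = s x * t z) :
    ∃ (c : ℂ) (φ : ι → EuclideanSpace ℂ (Fin 2)), v = c • productVector φ := by
  obtain ⟨g, hg⟩ : ∃ g : ℕ → ℂ, ∀ x, v x = g (weight x) := by
    have : ∀ k : ℕ, ∃ w : ℂ, ∀ x, weight x = k → v x = w := by
      intro k
      by_cases hk : ∃ x : ι → Fin 2, weight x = k
      · obtain ⟨x, hx⟩ := hk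
        refine ⟨v x, fun y hy => ?_⟩
        obtain ⟨π, rfl⟩ := exists_perm_of_weight_eq (hx.trans hy.symm)
        exact hv π x
      · exact ⟨0, fun x hx => (hk ⟨x, hx⟩).elim⟩
    choose g hg using this
    exact ⟨g, fun x => hg _ x rfl⟩
  have hcard : Fintype.card {i // i ∈ S} + Fintype.card {i // i ∉ S} = Fintype.card ι := by
    rw [← Fintype.card_sum]
    exact Fintype.card_congr (Equiv.sumCompl (fun i => i ∈ S))
  have hp : 1 ≤ Fintype.card {i // i ∈ S} :=
    Fintype.card_pos_iff.2 (hS.elim fun i hi => ⟨⟨i, hi⟩⟩)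
  have hq : 1 ≤ Fintype.card {i // i ∉ S} :=
    Fintype.card_pos_iff.2 (hS'.elim fun i hi => ⟨⟨i, mem_compl.1 hi⟩⟩)
  rcases hankel_rank_one (g := g) hp hq (by
      intro i hi i' hi' j hj j' hj'
      obtain ⟨x, rfl⟩ := exists_weight_eq hi
      obtain ⟨x', rfl⟩ := exists_weight_eq hi'
      obtain ⟨z, rfl⟩ := exists_weight_eq hj
      obtain ⟨z', rfl⟩ := exists_weight_eq hj'
      simp only [← weight_glue, ← hg, hst]
      ring) with ⟨c, r, h⟩ | h
  · refine ⟨c, fun _ => !₂[1, r], ?_⟩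
    rw [productVector_one_const]
    funext x
    rw [hg, h _ (hcard ▸ weight_le x)]
    rfl
  · refine ⟨g (Fintype.card ι), fun _ => !₂[0, 1], ?_⟩
    rw [productVector_ones]
    funext x
    rw [hg, Pi.smul_apply, smul_eq_mul]
    split_ifs with hx
    · rw [hx, mul_one]
    · rw [h _ (hcard ▸ lt_of_le_of_ne (weight_le x) hx), mul_zero]

/-- A biseparable operator is a sum of rank one operators of vectors that are products across
some bipartition. -/
lemma IsBiseparable.exists_sum_ketbra {d : ℕ} {ρ : Op ι d} (hρ : IsBiseparable ρ) :
    ∃ (κ : Type) (_ : Fintype κ) (v : κ → (ι → Fin d) → ℂ), ρ = ∑ k, ketbra (v k) ∧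
      ∀ k, ∃ S : Finset ι, S.Nonempty ∧ Sᶜ.Nonempty ∧
        ∃ (s : ({i // i ∈ S} → Fin d) → ℂ) (t : ({i // i ∉ S} → Fin d) → ℂ),
          ∀ x z, v k (glue S x z) = s x * t z := by
  let C : Set (Op ι d) := {ρ | ∃ (κ : Type) (_ : Fintype κ) (v : κ → (ι → Fin d) → ℂ),
    ρ = ∑ k, ketbra (v k) ∧
      ∀ k, ∃ S : Finset ι, S.Nonempty ∧ Sᶜ.Nonempty ∧
        ∃ (s : ({i // i ∈ S} → Fin d) → ℂ) (t : ({i // i ∉ S} → Fin d) → ℂ),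
          ∀ x z, v k (glue S x z) = s x * t z}
  have hC : Convex ℝ C := by
    rintro _ ⟨κ, _, v, rfl, hv⟩ _ ⟨κ', _, v', rfl, hv'⟩ p q hp hq -
    have key : ∀ {r : ℝ}, 0 ≤ r → ∀ w : (ι → Fin d) → ℂ,
        ketbra (((√r : ℝ) : ℂ) • w) = r • ketbra w := fun hr w => by
      rw [ketbra_smul, Complex.norm_real, Real.norm_eq_abs, sq_abs, Real.sq_sqrt hr]
    refine ⟨κ ⊕ κ', inferInstance, Sum.elim (fun k => ((√p : ℝ) : ℂ) • v k)
      (fun k => ((√q : ℝ) : ℂ) • v' k), ?_, ?_⟩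
    · simp only [Fintype.sum_sum_type, Sum.elim_inl, Sum.elim_inr, key hp, key hq, smul_sum]
    · rintro (k | k)
      · obtain ⟨S, h1, h2, s, t, h⟩ := hv k
        refine ⟨S, h1, h2, ((√p : ℝ) : ℂ) • s, t, fun x z => ?_⟩
        simp [h, mul_assoc]
      · obtain ⟨S, h1, h2, s, t, h⟩ := hv' k
        refine ⟨S, h1, h2, ((√q : ℝ) : ℂ) • s, t, fun x z => ?_⟩
        simp [h, mul_assoc]
  refine convexHull_min (t := C) ?_ hC hρ
  rintro _ ⟨S, hS, hS', σ, τ, hσ, hτ, rfl⟩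
  -- Rank one decompositions of both factors multiply out to vectors that are products across S.
  obtain ⟨m, s, rfl⟩ := Matrix.posSemidef_iff_eq_sum_vecMulVec.1 hσ.1
  obtain ⟨n, t, rfl⟩ := Matrix.posSemidef_iff_eq_sum_vecMulVec.1 hτ.1
  refine ⟨Fin m × Fin n, inferInstance,
    fun k x => s k.1 (fun i => x i) * t k.2 (fun i => x i), ?_,
    fun k => ⟨S, hS, hS', s k.1, t k.2, fun x z => ?_⟩⟩
  · ext x y
    simp only [splitProduct, Matrix.sum_apply, ketbra_apply, Fintype.sum_prod_type, sum_mul_sum,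
      Matrix.vecMulVec_apply, Pi.star_apply, star_mul']
    refine sum_congr rfl fun _ _ => sum_congr rfl fun _ _ => ?_
    ring
  · simp only [glue_mem, glue_not_mem]

/-- Entangled symmetric states of qubits are genuinely entangled. -/
lemma IsSymmetricState.isGenuinelyEntangled {ρ : Op ι 2} (hsym : IsSymmetricState ρ)
    (hent : IsEntangled ρ) : IsGenuinelyEntangled ρ := by
  refine ⟨hsym.1, fun hbi => hent.2 ?_⟩
  obtain ⟨κ, _, v, rfl, hv⟩ := hbi.exists_sum_ketbra
  have hprod : ∀ k, ∃ (c : ℂ) (φ : ι → EuclideanSpace ℂ (Fin 2)), v k = c • productVector φ := by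
    intro k
    obtain ⟨S, hS, hS', s, t, hst⟩ := hv k
    exact exists_eq_smul_productVector (symmetric_of_sum_ketbra v hsym.2 k) hS hS' s t hst
  choose c φ h using hprod
  refine isFullySeparable_of_eq_sum (c := fun k => ‖c k‖ ^ 2) (fun k => by positivity) φ ?_
    hsym.1.2
  exact sum_congr rfl fun k _ => by rw [h k, ketbra_smul]

end Symmetric

/-! ### States with amplitudes at weights 0 and n + 4 -/

section TwoLevel

variable {n : ℕ} {a β : ℂ} {ψ : (Fin (n + 7) → Fin 2) → ℂ}

/-- The unnormalised diagonal entry, on basis vectors with `i` ones, of the `k`-qubit reduction of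
a vector of `n + 7` qubits with amplitude `a` at weight `0` and `β` at weight `n + 4`. -/
noncomputable def levelEntry (n : ℕ) (a β : ℂ) (k i : ℕ) : ℝ :=
  (if i = 0 then ‖a‖ ^ 2 else 0) + ‖β‖ ^ 2 * (n + 7 - k).choose (n + 4 - i)

/-- Here i, i' are weights of the kept qubits and j that of the lost ones. A cross term between the
levels needs j = 0 and i or i' equal to n + 4, which exceeds 3. -/
lemma amplitude_mul_star (a β : ℂ) {i i' : ℕ} (hi : i ≤ 3) (hi' : i' ≤ 3) (j : ℕ) :
    ((if i + j = 0 then a else 0) + (if i + j = n + 4 then β else 0)) *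
        star ((if i' + j = 0 then a else 0) + (if i' + j = n + 4 then β else 0)) =
      if i = i' then
        (((if j = 0 then (if i = 0 then ‖a‖ ^ 2 else 0) else 0) +
          (if j = n + 4 - i then ‖β‖ ^ 2 else 0) : ℝ) : ℂ)
      else 0 := by
  have key : ∀ z : ℂ, z * star z = ((‖z‖ ^ 2 : ℝ) : ℂ) := fun z => by
    rw [Complex.star_def, Complex.mul_conj, Complex.normSq_eq_norm_sq]
  by_cases h : i = i'
  · subst h
    rw [key, if_pos rfl]
    congr 1
    by_cases h1 : i + j = 0
    · have h2 : i = 0 := by omega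
      have h3 : j = 0 := by omega
      simp [h2, h3]
    · by_cases h2 : i + j = n + 4
      · have h3 : j = n + 4 - i := by omega
        have h4 : j ≠ 0 := by omega
        rw [if_neg h1, if_pos h2, if_pos h3, if_neg h4, zero_add, zero_add]
      · have h3 : j ≠ n + 4 - i := by omega
        have h4 : ¬ (j = 0 ∧ i = 0) := by omega
        rw [if_neg h1, if_neg h2, if_neg h3, ← ite_and, if_neg h4]
        simp
  · rw [if_neg h]
    split_ifs <;> first | omega | simp

variable (hψ : ∀ x, ψ x = (if weight x = 0 then a else 0) + (if weight x = n + 4 then β else 0))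

include hψ

lemma reduction_twoLevel {T : Finset (Fin (n + 7))} {k : ℕ} (hT : T.card = k) (hk : k ≤ 3)
    (x y : {i // i ∈ T} → Fin 2) :
    reduction (pureState ψ) T x y =
      if weight x = weight y then
        (((∑ x, ‖ψ x‖ ^ 2)⁻¹ * levelEntry n a β k (weight x) : ℝ) : ℂ) else 0 := by
  have hcard : Fintype.card {i // i ∉ T} = n + 7 - k := by
    rw [Fintype.card_of_subtype Tᶜ (fun i => mem_compl), card_compl, Fintype.card_fin, hT]
  have hcardT : Fintype.card {i // i ∈ T} = k := by simpa using hT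
  have hx : weight x ≤ k := hcardT ▸ weight_le x
  have hy : weight y ≤ k := hcardT ▸ weight_le y
  simp only [reduction_apply, pureState_apply, ← mul_sum]
  simp only [hψ (glue _ _ _), weight_glue]
  rw [sum_weight (fun j => ((if weight x + j = 0 then a else 0) +
    (if weight x + j = n + 4 then β else 0)) * star ((if weight y + j = 0 then a else 0) +
      (if weight y + j = n + 4 then β else 0))), hcard]
  simp only [amplitude_mul_star a β (hx.trans hk) (hy.trans hk)]
  by_cases h : weight x = weight y
  · simp only [if_pos h, Complex.ofReal_mul]
    congr 1
    simp only [nsmul_eq_mul]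
    have hmem : n + 4 - weight x ∈ range (n + 7 - k + 1) := by
      rw [mem_range]
      omega
    have : ∑ j ∈ range (n + 7 - k + 1), ((n + 7 - k).choose j : ℝ) *
        ((if j = 0 then (if weight x = 0 then ‖a‖ ^ 2 else 0) else 0) +
          (if j = n + 4 - weight x then ‖β‖ ^ 2 else 0)) = levelEntry n a β k (weight x) := by
      simp only [mul_add, sum_add_distrib, mul_ite, mul_zero, sum_ite_eq', hmem, if_true]
      simp [levelEntry, mul_comm]
    rw [← this]
    simp only [Complex.ofReal_sum, Complex.ofReal_mul, Complex.ofReal_natCast]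
  · simp only [if_neg h, smul_zero, sum_const_zero, mul_zero]

lemma isSymmetricState_pureState (hβ : β ≠ 0) : IsSymmetricState (pureState ψ) := by
  obtain ⟨x, hx⟩ : ∃ x : Fin (n + 7) → Fin 2, weight x = n + 4 :=
    exists_weight_eq (by simp)
  refine ⟨isState_pureState (x := x) (by simp [hψ, hx, hβ]), fun π x y => ?_⟩
  simp only [pureState_apply]
  rw [hψ (x ∘ π), weight_comp, ← hψ]

lemma isState_reduction (hβ : β ≠ 0) (T : Finset (Fin (n + 7))) :
    IsState (reduction (pureState ψ) T) := by
  obtain ⟨x, hx⟩ : ∃ x : Fin (n + 7) → Fin 2, weight x = n + 4 :=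
    exists_weight_eq (by simp)
  exact IsState.reduction_pureState (x := x) (by simp [hψ, hx, hβ]) T

lemma normalization_pos (hβ : β ≠ 0) : 0 < (∑ x, ‖ψ x‖ ^ 2)⁻¹ := by
  obtain ⟨x, hx⟩ : ∃ x : Fin (n + 7) → Fin 2, weight x = n + 4 :=
    exists_weight_eq (by simp)
  exact inv_pos.2 (sum_norm_sq_pos (x := x) (by simp [hψ, hx, hβ]))

lemma isSymmetricState_reduction (hβ : β ≠ 0) {T : Finset (Fin (n + 7))} (hT : T.card ≤ 3) :
    IsSymmetricState (reduction (pureState ψ) T) := by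
  refine ⟨isState_reduction hψ hβ T, fun π x y => ?_⟩
  rw [reduction_twoLevel hψ rfl hT, reduction_twoLevel hψ rfl hT, weight_comp]

lemma isEntangled_pureState (hβ : β ≠ 0) : IsEntangled (pureState ψ) := by
  refine ⟨(isSymmetricState_pureState hψ hβ).1, fun hsep => ?_⟩
  obtain ⟨u, hu⟩ : ∃ u : Fin (n + 5) → Fin 2, weight u = n + 3 := exists_weight_eq (by simp)
  -- The diagonal entries sit at weights n + 5 and n + 3, where ψ vanishes; the off-diagonal entry
  -- has weight n + 4 on both sides and is a positive multiple of |β|².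
  have h := hsep.minor_nonneg (x := Fin.cons 1 (Fin.cons 1 u)) (y := Fin.cons 0 (Fin.cons 0 u))
    (x' := Fin.cons 1 (Fin.cons 0 u)) (y' := Fin.cons 0 (Fin.cons 1 u))
    (fun i => by
      refine Fin.cases (by simp) (fun i => ?_) i
      exact Fin.cases (by simp) (fun i => by simp) i) 1
  have hpos := normalization_pos hψ hβ
  set c := (∑ x, ‖ψ x‖ ^ 2)⁻¹
  have hβ' : 0 < ‖β‖ ^ 2 := by positivity
  have hββ : β * star β = ((‖β‖ ^ 2 : ℝ) : ℂ) := by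
    rw [Complex.star_def, Complex.mul_conj, Complex.normSq_eq_norm_sq]
  have e1 : ψ (Fin.cons 1 (Fin.cons 1 u)) = 0 := by
    simp [hψ, weight_cons, hu]
    omega
  have e2 : ψ (Fin.cons 0 (Fin.cons 0 u)) = 0 := by
    simp [hψ, weight_cons, hu]
  have e3 : ψ (Fin.cons 1 (Fin.cons 0 u)) = β := by
    simp [hψ, weight_cons, hu]
    omega
  have e4 : ψ (Fin.cons 0 (Fin.cons 1 u)) = β := by
    simp [hψ, weight_cons, hu]
    omega
  rw [pureState_apply, pureState_apply, pureState_apply, e1, e2, e3, e4, hββ,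
    ← Complex.ofReal_mul, Complex.ofReal_re] at h
  simp only [zero_mul, mul_zero, Complex.zero_re] at h
  nlinarith [mul_pos hpos hβ']

omit hψ in
lemma cast_choose_two (m : ℕ) : ((m + 2).choose 2 : ℝ) = (m + 2) * (m + 1) / 2 := by
  rw [Nat.cast_choose_two]
  push_cast
  ring

omit hψ in
lemma cast_choose_three (m : ℕ) :
    ((m + 3).choose 3 : ℝ) = (m + 3) * (m + 2) * (m + 1) / 6 := by
  have h := Nat.choose_succ_right_eq (m + 3) 2
  have h' : ((m + 3).choose 3 : ℝ) * 3 = (m + 1 + 2).choose 2 * (m + 1) := by exact_mod_cast h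
  rw [cast_choose_two] at h'
  push_cast at h'
  linarith

-- Up to normalization these are α_1, α_2, α_3; none involves a.
omit hψ in
lemma levelEntry_three (n : ℕ) (a β : ℂ) :
    levelEntry n a β 3 1 = ‖β‖ ^ 2 * (n + 4) ∧
    levelEntry n a β 3 2 = ‖β‖ ^ 2 * ((n + 4) * (n + 3) / 2) ∧
    levelEntry n a β 3 3 = ‖β‖ ^ 2 * ((n + 4) * (n + 3) * (n + 2) / 6) := by
  have h2 := cast_choose_two (n + 2)
  have h3 := cast_choose_three (n + 1)
  have e1 : (n + 4).choose (n + 3) = n + 4 := Nat.choose_succ_self_right (n + 3)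
  have e2 : (n + 4).choose (n + 2) = (n + 4).choose 2 := Nat.choose_symm_of_eq_add (by omega)
  have e3 : (n + 4).choose (n + 1) = (n + 4).choose 3 := Nat.choose_symm_of_eq_add (by omega)
  simp only [levelEntry, show n + 7 - 3 = n + 4 by omega, show n + 4 - 1 = n + 3 by omega,
    show n + 4 - 2 = n + 2 by omega, show n + 4 - 3 = n + 1 by omega, e1, e2, e3]
  push_cast at h2 h3
  refine ⟨?_, ?_, ?_⟩
  · push_cast
    simp
  · simp only [OfNat.ofNat_ne_zero, if_false, zero_add, h2]
    ring
  · simp only [OfNat.ofNat_ne_zero, if_false, zero_add, h3]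
    ring

omit hψ in
lemma levelEntry_two (n : ℕ) (a β : ℂ) :
    levelEntry n a β 2 0 = ‖a‖ ^ 2 + ‖β‖ ^ 2 * (n + 5) ∧
    levelEntry n a β 2 1 = ‖β‖ ^ 2 * ((n + 5) * (n + 4) / 2) ∧
    levelEntry n a β 2 2 = ‖β‖ ^ 2 * ((n + 5) * (n + 4) * (n + 3) / 6) := by
  have h2 := cast_choose_two (n + 3)
  have h3 := cast_choose_three (n + 2)
  have e1 : (n + 5).choose (n + 4) = n + 5 := Nat.choose_succ_self_right (n + 4)
  have e2 : (n + 5).choose (n + 3) = (n + 5).choose 2 := Nat.choose_symm_of_eq_add (by omega)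
  have e3 : (n + 5).choose (n + 2) = (n + 5).choose 3 := Nat.choose_symm_of_eq_add (by omega)
  simp only [levelEntry, show n + 7 - 2 = n + 5 by omega, show n + 4 - 1 = n + 3 by omega,
    show n + 4 - 2 = n + 2 by omega, Nat.sub_zero, e1, e2, e3]
  push_cast at h2 h3
  refine ⟨?_, ?_, ?_⟩
  · push_cast
    simp
  · simp only [one_ne_zero, if_false, zero_add, h2]
    ring
  · simp only [OfNat.ofNat_ne_zero, if_false, zero_add, h3]
    ring

lemma isEntangled_reduction (hβ : β ≠ 0) {T : Finset (Fin (n + 7))} (hT : T.card = 3) :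
    IsEntangled (reduction (pureState ψ) T) := by
  refine ⟨isState_reduction hψ hβ T, fun hsep => ?_⟩
  have e : {i // i ∈ T} ≃ Fin 3 := Fintype.equivFinOfCardEq (by simpa using hT)
  -- Transposing the first qubit gives the form t² α_1 - 2t α_2 + α_3. Its minimum, at t = α_2/α_1 =
  -- (n+3)/2, is negative.
  have h := hsep.minor_nonneg (x := ![0, 0, 1] ∘ e) (y := ![1, 1, 1] ∘ e)
    (x' := ![1, 0, 1] ∘ e) (y' := ![0, 1, 1] ∘ e)
    (fun i => by
      simp only [Function.comp_apply]
      generalize e i = j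
      fin_cases j <;> simp) ((n + 3) / 2)
  have w1 : weight ![0, 0, 1] = 1 := by decide
  have w2 : weight ![1, 0, 1] = 2 := by decide
  have w2' : weight ![0, 1, 1] = 2 := by decide
  have w3 : weight ![1, 1, 1] = 3 := by decide
  have hpos := normalization_pos hψ hβ
  simp only [reduction_twoLevel hψ hT le_rfl, weight_comp, w1, w2, w2', w3, if_true,
    Complex.ofReal_re] at h
  obtain ⟨h1, h2, h3⟩ := levelEntry_three n a β
  rw [h1, h2, h3] at h
  set c := (∑ x, ‖ψ x‖ ^ 2)⁻¹
  have hβ' : 0 < ‖β‖ ^ 2 := by positivity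
  have hneg : 0 < c * ‖β‖ ^ 2 * ((n + 4) * (n + 3) * (n + 5) / 12) := by positivity
  nlinarith

lemma reduction_eq_dickeMixture (hβ : β ≠ 0) {T : Finset (Fin (n + 7))} (hT : T.card = 3) :
    ∃ p : ℕ → ℝ, reduction (pureState ψ) T = dickeMixture {i // i ∈ T} p ∧
      ¬ (hankelOne 3 p).PosSemidef := by
  have hpos := normalization_pos hψ hβ
  have hred := reduction_twoLevel hψ hT le_rfl
  set c := (∑ x, ‖ψ x‖ ^ 2)⁻¹
  -- The binomial undoes the normalization of the Dicke vectors, so α_i is the matrix entry itself.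
  refine ⟨fun i => Nat.choose 3 i * (c * levelEntry n a β 3 i), ?_, fun hpsd => ?_⟩
  · have hcard : Fintype.card {i // i ∈ T} = 3 := by simpa using hT
    ext x y
    have hx : weight x ≤ 3 := hcard ▸ weight_le x
    have hd : ∀ i x, dicke {i // i ∈ T} i x = if weight x = i then
        ((1 / Real.sqrt (Nat.choose 3 i) : ℝ) : ℂ) else 0 := by
      intro i x
      rw [← hcard]
      rfl
    rw [hred, dickeMixture, hcard, Matrix.sum_apply]
    rw [sum_eq_single_of_mem (weight x) (by rw [mem_range]; omega)]
    · rw [Matrix.smul_apply, ketbra_apply, hd, hd]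
      by_cases h : weight x = weight y
      · have hch : (0 : ℝ) < Nat.choose 3 (weight x) := by exact_mod_cast Nat.choose_pos hx
        rw [if_pos h, if_pos rfl, if_pos h.symm, Complex.star_def, Complex.conj_ofReal,
          Complex.real_smul, ← Complex.ofReal_mul, ← Complex.ofReal_mul, div_mul_div_comm,
          Real.mul_self_sqrt hch.le]
        congr 1
        field_simp
      · rw [if_neg h, if_neg (Ne.symm h)]
        simp
    · intro i _ hi
      rw [Matrix.smul_apply, ketbra_apply, hd, hd, if_neg (Ne.symm hi)]
      simp
  · have hdet : 0 ≤ Matrix.det (n := Fin 2) (hankelOne 3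
      fun i => Nat.choose 3 i * (c * levelEntry n a β 3 i)) := hpsd.det_nonneg
    rw [Matrix.det_fin_two] at hdet
    obtain ⟨h1, h2, h3⟩ := levelEntry_three n a β
    simp only [hankelOne] at hdet
    norm_num [Nat.choose, h1, h2, h3] at hdet
    have hβ' : 0 < ‖β‖ ^ 2 := by positivity
    have hneg : 0 < (c * ‖β‖ ^ 2) ^ 2 * ((n + 4) ^ 2 * (n + 3) * (n + 5) / 12) := by positivity
    nlinarith

/-- The hypothesis `ha` is α_0 α_2 ≥ α_1² with common factors cancelled. Averaging the projectors
onto (1, rω)⊗(1, rω) over fourth roots of unity ω kills all entries between different weights; the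
excess of α_0 goes to |00⟩. -/
lemma isFullySeparable_reduction_two (hβ : β ≠ 0)
    (ha : ‖β‖ ^ 2 * (3 * (n + 5) * (n + 4)) ≤
      (‖a‖ ^ 2 + ‖β‖ ^ 2 * (n + 5)) * (2 * (n + 3)))
    {T : Finset (Fin (n + 7))} (hT : T.card = 2) :
    IsFullySeparable (reduction (pureState ψ) T) := by
  have hpos := normalization_pos hψ hβ
  have hred := reduction_twoLevel hψ hT (by norm_num)
  set c := (∑ x, ‖ψ x‖ ^ 2)⁻¹
  obtain ⟨h0, h1, h2⟩ := levelEntry_two n a β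
  -- q = α_1²/α_2 and r² = α_2/α_1, so that q, q r², q r⁴ is the geometric sequence ending in α_1,
  -- α_2.
  set q : ℝ := ‖β‖ ^ 2 * (3 * (n + 5) * (n + 4)) / (2 * (n + 3)) with hq
  set r : ℝ := Real.sqrt ((n + 3) / 3)
  have hr : r ^ 2 = (n + 3) / 3 := Real.sq_sqrt (by positivity)
  have hn : (n : ℝ) + 3 ≠ 0 := by positivity
  have hq0 : 0 ≤ q := by positivity
  have hq1 : q ≤ levelEntry n a β 2 0 := by
    rw [h0, hq, div_le_iff₀ (by positivity)]
    exact ha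
  have e1 : levelEntry n a β 2 1 = q * r ^ 2 := by
    rw [h1, hr, hq]
    field_simp
  have e2 : levelEntry n a β 2 2 = q * r ^ 4 := by
    rw [h2, show r ^ 4 = (r ^ 2) ^ 2 by ring, hr, hq]
    field_simp
    ring
  have hcard : Fintype.card {i // i ∈ T} = 2 := by simpa using hT
  refine isFullySeparable_of_eq_sum (κ := Fin 5)
    (c := ![c * (q / 4), c * (q / 4), c * (q / 4), c * (q / 4), c * (levelEntry n a β 2 0 - q)])
    ?_ (fun k _ => !₂[1, (![(r : ℂ), r * Complex.I, -r, -(r * Complex.I), 0] : Fin 5 → ℂ) k])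
    ?_ (isState_reduction hψ hβ T).2
  · have : 0 ≤ c * (q / 4) := by positivity
    have := mul_nonneg hpos.le (sub_nonneg.2 hq1)
    intro k
    fin_cases k <;> assumption
  · ext x y
    have hx : weight x ≤ 2 := hcard ▸ weight_le x
    have hy : weight y ≤ 2 := hcard ▸ weight_le y
    simp only [productVector_one_const, Matrix.sum_apply, Matrix.smul_apply, ketbra_apply, hred,
      Complex.real_smul]
    generalize weight x = i at *
    generalize weight y = j at *
    simp only [Fin.sum_univ_five]
    interval_cases i <;> interval_cases j <;>
      simp [e1, e2, mul_pow] <;> ring_nf <;> simp <;> ring_nf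

end TwoLevel

end ParticleLoss

/-! ### The main theorem -/

open ParticleLoss
theorem mainTheorem3 (N : ℕ) (hN : 7 ≤ N) (a b : ℂ) (hb : b ≠ 0)
    (hab : ‖a‖ ^ 2 ≥ 6 * (2 * (N : ℝ) - 5) / ((N : ℝ) * ((N : ℝ) - 1) * ((N : ℝ) - 4)) * ‖b‖ ^ 2)
    (ψ : (Fin N → Fin 2) → ℂ)
    (hψ : ψ = a • dicke (Fin N) 0 + b • dicke (Fin N) (N - 3)) :
    -- the state is strong (N-3)-resistant
    IsStrongResistant ψ (N - 3) ∧
    -- its 2-qubit reductions are fully separable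
    (∀ T : Finset (Fin N), T.card = 2 → IsFullySeparable (reduction (pureState ψ) T)) ∧
    -- its 3-qubit reductions are symmetric, entangled and genuinely entangled, and they are
    -- mixtures of Dicke states whose Hankel matrix M₁ is not positive semidefinite
    (∀ T : Finset (Fin N), T.card = 3 →
      IsSymmetricState (reduction (pureState ψ) T) ∧
      IsEntangled (reduction (pureState ψ) T) ∧
      IsGenuinelyEntangled (reduction (pureState ψ) T) ∧
      ∃ p : ℕ → ℝ, reduction (pureState ψ) T = dickeMixture {i // i ∈ T} p ∧
        ¬ (hankelOne 3 p).PosSemidef) ∧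
    -- entangled symmetric multi-qubit states are genuinely entangled
    (∀ (ι : Type) [Fintype ι] [DecidableEq ι] (ρ : Op ι 2),
      IsSymmetricState ρ → IsEntangled ρ → IsGenuinelyEntangled ρ) := by
  obtain ⟨n, rfl⟩ := Nat.exists_eq_add_of_le' hN
  have hchoose : ((n + 7).choose (n + 4) : ℝ) = (n + 7) * (n + 6) * (n + 5) / 6 := by
    rw [Nat.choose_symm_of_eq_add (show n + 7 = (n + 4) + 3 by omega), cast_choose_three (n + 4)]
    push_cast
    ring
  obtain ⟨β, hβdef⟩ : ∃ β : ℂ, β = b * ((1 / Real.sqrt ((n + 7).choose (n + 4)) : ℝ) : ℂ) :=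
    ⟨_, rfl⟩
  have hchoose_pos : (0 : ℝ) < (n + 7).choose (n + 4) := by
    rw [hchoose]
    positivity
  have hβ : β ≠ 0 := by
    rw [hβdef]
    refine mul_ne_zero hb (Complex.ofReal_ne_zero.2 ?_)
    positivity
  have hnorm : ‖b‖ ^ 2 = ‖β‖ ^ 2 * ((n + 7) * (n + 6) * (n + 5) / 6) := by
    rw [hβdef, norm_mul, mul_pow, Complex.norm_real, Real.norm_eq_abs, sq_abs, div_pow,
      Real.sq_sqrt hchoose_pos.le, ← hchoose]
    field_simp
  have hψ' : ∀ x, ψ x =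
      (if weight x = 0 then a else 0) + (if weight x = n + 4 then β else 0) := by
    intro x
    simp [hψ, dicke, weight, hβdef]
  have ha : ‖β‖ ^ 2 * (3 * (n + 5) * (n + 4)) ≤
      (‖a‖ ^ 2 + ‖β‖ ^ 2 * (n + 5)) * (2 * (n + 3)) := by
    have h : ‖β‖ ^ 2 * ((2 * n + 9) * (n + 5)) ≤ ‖a‖ ^ 2 * (n + 3) := by
      rw [ge_iff_le, hnorm] at hab
      push_cast at hab
      rw [← div_le_iff₀ (by positivity)]
      refine le_of_eq_of_le ?_ hab
      rw [show (n : ℝ) + 7 - 1 = n + 6 by ring, show (n : ℝ) + 7 - 4 = n + 3 by ring]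
      field_simp
      ring
    -- This is the slack by which twice `h` exceeds the required inequality.
    have : 0 ≤ ‖β‖ ^ 2 * ((3 * n + 12) * (n + 5)) := by positivity
    nlinarith
  have htwo := fun (T : Finset (Fin (n + 7))) (hT : T.card = 2) =>
    isFullySeparable_reduction_two hψ' hβ ha hT
  have hthree := fun (T : Finset (Fin (n + 7))) (hT : T.card = 3) =>
    (isSymmetricState_reduction hψ' hβ hT.le).isGenuinelyEntangled
      (isEntangled_reduction hψ' hβ hT)
  refine ⟨⟨(isSymmetricState_pureState hψ' hβ).isGenuinelyEntangled
      (isEntangled_pureState hψ' hβ), fun J hJ => hthree _ ?_, fun J hJ => htwo _ ?_⟩, htwo,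
    fun T hT => ⟨isSymmetricState_reduction hψ' hβ hT.le, isEntangled_reduction hψ' hβ hT,
      hthree T hT, reduction_eq_dickeMixture hψ' hβ hT⟩,
    fun ι _ _ ρ hsym hent => hsym.isGenuinelyEntangled hent⟩
  · rw [Finset.card_compl, Fintype.card_fin, hJ]
    omega
  · rw [Finset.card_compl, Fintype.card_fin, hJ]
    omega
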